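/- **Lemma (lower bound given known distributions).** Let $K\ge 2$, let $[K]=\{1,\dots,K\}$ be the set of arms, and let $\sigma^1,\dots,\sigma^K>0$. An instance $P$ is a joint law of integrable outcomes $(Y^1,\dots,Y^K)$, with means $\mu^a(P)=\mathbb E_P[Y^a]$, that has a unique best arm $a^*(P)=\arg\max_a\mu^a(P)$. Let $\mathcal P$ be any class of such instances (for example all of them) that contains the product law $\bigotimes_{a}\mathcal N(m^a,(\sigma^a)^2)$ for every $m\in\mathbb R^K$ with a unique maximal coordinate. A strategy $\pi$ specifies, for every budget $T$, arms $A_1,\dots,A_T\in[K]$ and a recommendation $\widehat a_T^\pi\in[K]$. Here $(Y_t^1,\dots,Y_t^K)_{t\ge1}$ are i.i.d. copies of $(Y^1,\dots,Y^K)$ under $P$, $Y_t=Y_t^{A_t}$ is the observed outcome, $A_t$ is a measurable function of $(A_s,Y_s)_{s<t}$, and $\widehat a_T^\pi$ is a measurable function of $(A_s,Y_s)_{s\le T}$. Put $\mathcal W=\{w:[K]\to(0,1)\mid\sum_a w(a)=1\}$. * $\pi$ is *consistent* if $\mathbb P_P(\widehat a_T^\pi=a^*(P))\to1$ as $T\to\infty$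 for every $P\in\mathcal P$. * $\pi$ is *asymptotically invariant* if there is a $w^\pi\in\mathcal W$ such that $\mathbb E_P\big[\frac1T\sum_{t=1}^T\mathbf 1[A_t=a]\big]\to w^\pi(a)$ as $T\to\infty$ for every $P\in\mathcal P$ and every $a\in[K]$. For $a^*\in[K]$ and $0<\underline\Delta\le\overline\Delta<\infty$, let $\mathcal P^{\mathrm G}(a^*,\underline\Delta,\overline\Delta)$ be the set of all $P\in\mathcal P$ such that $Y^a\sim\mathcal N(\mu^a(P),(\sigma^a)^2)$ for all $a\in[K]$ and $\underline\Delta\le\mu^{a^*}(P)-\mu^a(P)\le\overline\Delta$ for all $a\ne a^*$. Then for all $0<\underline\Delta\le\overline\Delta<\infty$, all $a^*\in[K]$, all $P_0\in\mathcal P^{\mathrm G}(a^*,\underline\Delta,\overline\Delta)$ and every consistent and asymptotically invariant strategy $\pi$, $$\limsup_{T\to\infty}-\frac1T\log\mathbb P_{P_0}\big(\widehat a^\pi_T\ne a^*\big)\;\le\;\sup_{w\in\mathcal W}\ \min_{a\in[K]\setminus\{a^*\}}\frac{(\Delta^a(P_0))^2}{2\,\Omega^{a^*,a}(w)},$$ where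 $\Delta^a(P_0)=\mu^{a^*}(P_0)-\mu^a(P_0)$, $\Omega^{a^*,a}(w)=\frac{(\sigma^{a^*})^2}{w(a^*)}+\frac{(\sigma^a)^2}{w(a)}$ and $-\log 0=+\infty$. -/

import Mathlib

open Filter Topology MeasureTheory ProbabilityTheory
open scoped NNReal ENNReal

noncomputable section

namespace FixedBudgetBAI

/-- An instance of the `K`-armed bandit: the joint law of the potential outcomes
`(Y^1, …, Y^K)` of one round. -/
abbrev Instance (K : ℕ) : Type := ProbabilityMeasure (Fin K → ℝ)

variable {K : ℕ}

/-- The expected outcome `μ^a(P)` of arm `a` under `P`. -/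
def mean (P : Instance K) (a : Fin K) : ℝ :=
  ∫ y, y a ∂(P : Measure (Fin K → ℝ))

/-- `a` is the unique best arm `a^*(P)` of `P`. -/
def IsBestArm (P : Instance K) (a : Fin K) : Prop :=
  ∀ b, b ≠ a → mean P b < mean P a

/-- All joint laws of integrable potential outcomes that have a unique best arm. -/
def uniqueBestArmInstances (K : ℕ) : Set (Instance K) :=
  {P | (∀ a, Integrable (fun y : Fin K → ℝ => y a) (P : Measure (Fin K → ℝ))) ∧
    ∃ a, IsBestArm P a}

/-- The instance with independent arms and outcome laws `N(m a, (σ a)²)`. -/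
def indepGaussian (m : Fin K → ℝ) (σ : Fin K → ℝ≥0) : Instance K :=
  ⟨Measure.pi fun a => gaussianReal (m a) (σ a ^ 2), inferInstance⟩

/-- The Gaussian bandit model: the instances `P ∈ M` such that `Y^a` has law
`N(μ^a(P), (σ a)²)` for every arm `a`, and the gap between `aStar` and every other arm
lies in `[Δlo, Δhi]`. -/
def gaussianModel (M : Set (Instance K)) (σ : Fin K → ℝ≥0) (aStar : Fin K) (Δlo Δhi : ℝ) :
    Set (Instance K) :=
  {P | P ∈ M ∧
    (∀ a, (P : Measure (Fin K → ℝ)).map (fun y => y a) = gaussianReal (mean P a) (σ a ^ 2)) ∧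
    ∀ a, a ≠ aStar → Δlo ≤ mean P aStar - mean P a ∧ mean P aStar - mean P a ≤ Δhi}

/-- A strategy. For every budget `T`, the arm of each round is a measurable function of the
arms and outcomes observed in the previous rounds, and the recommended arm is a measurable
function of all `T` observations. Rounds are numbered from `0`, so that `t` observations are
available in round `t`; only the rounds `t < T` are used. -/
structure Strategy (K : ℕ) where
  alloc : (T t : ℕ) → (Fin t → Fin K × ℝ) → Fin K
  recommend : (T : ℕ) → (Fin T → Fin K × ℝ) → Fin K
  measurable_alloc : ∀ T t, Measurable (alloc T t)
  measurable_recommend : ∀ T, Measurable (recommend T)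

namespace Strategy

/-- The observations `(A_s, Y_s)`, `s < t`, when the budget is `T` and the potential outcomes
are `y`; here `y s a` is the potential outcome of arm `a` in round `s`. -/
def history (π : Strategy K) (T : ℕ) (y : ℕ → Fin K → ℝ) : (t : ℕ) → (Fin t → Fin K × ℝ)
  | 0 => Fin.elim0
  | t + 1 =>
    Fin.snoc (α := fun _ => Fin K × ℝ) (π.history T y t)
      (π.alloc T t (π.history T y t), y t (π.alloc T t (π.history T y t)))

/-- The arm `A_t` allocated in round `t`. -/
def arm (π : Strategy K) (T t : ℕ) (y : ℕ → Fin K → ℝ) : Fin K :=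
  π.alloc T t (π.history T y t)

/-- The recommended arm `â_T`. -/
def recommended (π : Strategy K) (T : ℕ) (y : ℕ → Fin K → ℝ) : Fin K :=
  π.recommend T (π.history T y T)

end Strategy

/-- The law of the potential outcomes of all rounds: i.i.d. copies from `P`. -/
def outcomeLaw (P : Instance K) : Measure (ℕ → Fin K → ℝ) :=
  Measure.infinitePi fun _ : ℕ => (P : Measure (Fin K → ℝ))

/-- The average sample allocation ratio `E_P[(1/T) ∑_t 1[A_t = a]]`. -/
def allocationRatio (π : Strategy K) (T : ℕ) (P : Instance K) (a : Fin K) : ℝ :=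
  ∫ y, (1 / (T : ℝ)) * ∑ t ∈ Finset.range T, (if π.arm T t y = a then (1 : ℝ) else 0)
    ∂(outcomeLaw P)

/-- The allocation ratios: functions `w : [K] → (0, 1)` with `∑ a, w a = 1`. -/
def allocations (K : ℕ) : Set (Fin K → ℝ) :=
  {w | (∀ a, w a ∈ Set.Ioo (0 : ℝ) 1) ∧ ∑ a, w a = 1}

/-- `π` recommends the best arm with probability tending to one under every `P ∈ M`. -/
def IsConsistent (M : Set (Instance K)) (π : Strategy K) : Prop :=
  ∀ P ∈ M, ∀ a, IsBestArm P a →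
    Tendsto (fun T : ℕ => outcomeLaw P {y | π.recommended T y = a}) atTop (𝓝 1)

/-- The average allocation of `π` has a limit `w` that is the same under every `P ∈ M`. -/
def IsAsymptoticallyInvariant (M : Set (Instance K)) (π : Strategy K) : Prop :=
  ∃ w ∈ allocations K, ∀ P ∈ M, ∀ a,
    Tendsto (fun T : ℕ => allocationRatio π T P a) atTop (𝓝 (w a))

/-- The complexity `-(1/T) log ℙ_P(â_T ≠ aStar)`, with `-log 0 = +∞`. -/
def complexity (π : Strategy K) (P : Instance K) (aStar : Fin K) (T : ℕ) : EReal :=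
  ((-(1 / (T : ℝ)) : ℝ) : EReal) * ENNReal.log (outcomeLaw P {y | π.recommended T y ≠ aStar})

/-- `Ω^{a,b}(w) = (σ a)² / w a + (σ b)² / w b`. -/
def Omega (σ : Fin K → ℝ≥0) (a b : Fin K) (w : Fin K → ℝ) : ℝ :=
  (σ a : ℝ) ^ 2 / w a + (σ b : ℝ) ^ 2 / w b

end FixedBudgetBAI

end

namespace FixedBudgetBAI

variable {K : ℕ}

/-! The proof is a change of measure from `P₀` to a Gaussian alternative `Q` with another best arm.
Let `q` be the probability under `Q` of not recommending `aStar`; consistency gives `q → 1`. If `D`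
is the expected log-likelihood ratio of the history under `Q`, then the error probability under `P₀`
is at least `q * exp (-(D + 1) / q)` (`ofReal_mul_exp_le_setLIntegral`). One arm per round is
observed, so only marginal laws enter, and `D` is `T` times the sum of the allocation ratios under
`Q` weighted by the Gaussian divergences (`integral_historyLogRatio`). Invariance replaces the
ratios under `Q` by the same `w` for every alternative. It remains to choose, for each `b ≠ aStar`,
the cheapest means at which `b` ties with `aStar` (`cost_of_equalizing`), to break ties by `ε`, and
to let `ε → 0`. The bound holds for all `b` with one `w`, hence the supremum of minima. -/

instance (P : Instance K) : IsProbabilityMeasure (outcomeLaw P) := by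
  unfold outcomeLaw; infer_instance

lemma measurable_apply_index : Measurable fun p : Fin K × (Fin K → ℝ) => p.2 p.1 :=
  measurable_from_prod_countable_right fun a => measurable_pi_apply a

lemma measurable_snoc {α : Type*} [MeasurableSpace α] (t : ℕ) :
    Measurable fun p : (Fin t → α) × α =>
      (Fin.snoc (α := fun _ => α) p.1 p.2 : Fin (t + 1) → α) := by
  refine measurable_pi_iff.2 fun i => ?_
  induction i using Fin.lastCases with
  | last => simpa using measurable_snd
  | cast i =>
    simp only [Fin.snoc_castSucc]
    exact (measurable_pi_apply i).comp measurable_fst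

/-! ### Histories and their independence of the next round -/

namespace Strategy

variable (π : Strategy K) (T : ℕ)

/-- The history after one more round, from the past history and the potential outcomes of the
new round. -/
def extend (t : ℕ) (p : (Fin t → Fin K × ℝ) × (Fin K → ℝ)) : Fin (t + 1) → Fin K × ℝ :=
  Fin.snoc (α := fun _ => Fin K × ℝ) p.1 (π.alloc T t p.1, p.2 (π.alloc T t p.1))

lemma history_succ (y : ℕ → Fin K → ℝ) (t : ℕ) :
    π.history T y (t + 1) = π.extend T t (π.history T y t, y t) := rfl

lemma measurable_extend (t : ℕ) : Measurable (π.extend T t) := by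
  have h1 : Measurable fun p : (Fin t → Fin K × ℝ) × (Fin K → ℝ) => π.alloc T t p.1 :=
    (π.measurable_alloc T t).comp measurable_fst
  exact (measurable_snoc t).comp
    (measurable_fst.prodMk (h1.prodMk (measurable_apply_index.comp (h1.prodMk measurable_snd))))

lemma measurable_history (t : ℕ) : Measurable fun y => π.history T y t := by
  induction t with
  | zero => exact measurable_const
  | succ t ih => exact (π.measurable_extend T t).comp (ih.prodMk (measurable_pi_apply t))

lemma measurable_arm (t : ℕ) : Measurable (π.arm T t) :=
  (π.measurable_alloc T t).comp (π.measurable_history T t)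

lemma history_congr {y z : ℕ → Fin K → ℝ} {t : ℕ} (h : ∀ s < t, y s = z s) :
    π.history T y t = π.history T z t := by
  induction t with
  | zero => rfl
  | succ t ih =>
    rw [history_succ, history_succ, ih fun s hs => h s (hs.trans t.lt_succ_self), h t t.lt_succ_self]

/-- The history of the first `t` rounds is independent of the outcomes of round `t`. -/
lemma indepFun_history (P : Instance K) (t : ℕ) :
    IndepFun (fun y => π.history T y t) (fun y => y t) (outcomeLaw P) := by
  have hind : iIndepFun (fun (i : ℕ) (y : ℕ → Fin K → ℝ) => y i) (outcomeLaw P) :=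
    iIndepFun_infinitePi (P := fun _ : ℕ => (P : Measure (Fin K → ℝ)))
      (X := fun _ y => y) fun _ => measurable_id
  have h := hind.indepFun_finset (Finset.range t) {t} (by simp) fun i => measurable_pi_apply i
  -- Padding the first `t` rounds with zeros exhibits the history as a measurable function of these
  -- rounds alone.
  have hext : Measurable fun (z : Finset.range t → Fin K → ℝ) (s : ℕ) =>
      if hs : s ∈ Finset.range t then z ⟨s, hs⟩ else 0 := by
    refine measurable_pi_iff.2 fun s => ?_
    by_cases hs : s ∈ Finset.range t
    · simpa only [hs, dite_true] using measurable_pi_apply _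
    · simpa only [hs, dite_false] using measurable_const
  have h' := h.comp ((π.measurable_history T t).comp hext)
    (measurable_pi_apply (⟨t, Finset.mem_singleton_self t⟩ : ({t} : Finset ℕ)))
  refine h'.congr (Eventually.of_forall fun y => ?_) (Eventually.of_forall fun y => rfl)
  refine π.history_congr T fun s hs => ?_
  simp [hs]

lemma map_eval_outcomeLaw (P : Instance K) (t : ℕ) :
    (outcomeLaw P).map (fun y => y t) = (P : Measure (Fin K → ℝ)) :=
  (measurePreserving_eval_infinitePi (fun _ : ℕ => (P : Measure (Fin K → ℝ))) t).map_eq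

lemma lintegral_history_prod (P : Instance K) (t : ℕ)
    {f : (Fin t → Fin K × ℝ) × (Fin K → ℝ) → ℝ≥0∞} (hf : Measurable f) :
    ∫⁻ y, f (π.history T y t, y t) ∂outcomeLaw P =
      ∫⁻ y, ∫⁻ x, f (π.history T y t, x) ∂(P : Measure (Fin K → ℝ)) ∂outcomeLaw P := by
  have hm := π.measurable_history T t
  have h := (indepFun_iff_map_prod_eq_prod_map_map hm.aemeasurable
    (measurable_pi_apply t).aemeasurable).1 (π.indepFun_history T P t)
  rw [map_eval_outcomeLaw] at h
  rw [← lintegral_map hf (hm.prodMk (measurable_pi_apply t)), h, lintegral_prod _ hf.aemeasurable,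
    lintegral_map hf.lintegral_prod_right' hm]

end Strategy

/-! ### Likelihood ratios and change of measure -/

/-- The log-likelihood ratio of the observation `(a, z)` between the Gaussian outcome laws with
means `m` and with means `μ`. -/
noncomputable def logRatio (μ m : Fin K → ℝ) (σ : Fin K → ℝ≥0) (p : Fin K × ℝ) : ℝ :=
  (m p.1 - μ p.1) * (2 * p.2 - m p.1 - μ p.1) / (2 * (σ p.1 : ℝ) ^ 2)

lemma measurable_logRatio (μ m : Fin K → ℝ) (σ : Fin K → ℝ≥0) : Measurable (logRatio μ m σ) :=
  measurable_from_prod_countable_right fun a => by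
    unfold logRatio; fun_prop

lemma lintegral_gaussianReal_change_mean (μ m : Fin K → ℝ) {σ : Fin K → ℝ≥0} {a : Fin K}
    (hσ : 0 < σ a) {f : ℝ → ℝ≥0∞} (hf : Measurable f) :
    ∫⁻ z, f z ∂gaussianReal (μ a) (σ a ^ 2) =
      ∫⁻ z, f z * ENNReal.ofReal (Real.exp (-logRatio μ m σ (a, z)))
        ∂gaussianReal (m a) (σ a ^ 2) := by
  have hv : σ a ^ 2 ≠ 0 := (pow_pos hσ 2).ne'
  have hr : (σ a : ℝ) ≠ 0 := by exact_mod_cast hσ.ne'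
  have hlog : Measurable fun z => logRatio μ m σ (a, z) :=
    (measurable_logRatio μ m σ).comp measurable_prodMk_left
  rw [gaussianReal_of_var_ne_zero _ hv, gaussianReal_of_var_ne_zero _ hv,
    lintegral_withDensity_eq_lintegral_mul _ (measurable_gaussianPDF _ _) hf,
    lintegral_withDensity_eq_lintegral_mul _ (measurable_gaussianPDF _ _) (by fun_prop)]
  refine lintegral_congr fun z => ?_
  simp only [Pi.mul_apply, gaussianPDF, gaussianPDFReal_def]
  rw [mul_left_comm, ← ENNReal.ofReal_mul (by positivity), mul_comm, mul_assoc (Inv.inv _),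
    ← Real.exp_add]
  congr 4
  simp only [logRatio, NNReal.coe_pow]
  field_simp
  ring

/-- The log-likelihood ratio of a history. -/
noncomputable def historyLogRatio (μ m : Fin K → ℝ) (σ : Fin K → ℝ≥0) {t : ℕ} (h : Fin t → Fin K × ℝ) : ℝ :=
  ∑ s, logRatio μ m σ (h s)

lemma measurable_historyLogRatio (μ m : Fin K → ℝ) (σ : Fin K → ℝ≥0) (t : ℕ) :
    Measurable (historyLogRatio μ m σ (t := t)) :=
  Finset.measurable_sum _ fun s _ => (measurable_logRatio μ m σ).comp (measurable_pi_apply s)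

namespace Strategy

variable (π : Strategy K) (T : ℕ)

lemma historyLogRatio_extend (μ m : Fin K → ℝ) (σ : Fin K → ℝ≥0) (t : ℕ)
    (p : (Fin t → Fin K × ℝ) × (Fin K → ℝ)) :
    historyLogRatio μ m σ (π.extend T t p) = historyLogRatio μ m σ p.1 +
      logRatio μ m σ (π.alloc T t p.1, p.2 (π.alloc T t p.1)) := by
  simp [historyLogRatio, extend, Fin.sum_univ_castSucc]

/-- Change of measure for the history: only the marginal outcome laws matter. -/
lemma lintegral_history_change_mean {P Q : Instance K} {μ m : Fin K → ℝ} {σ : Fin K → ℝ≥0}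
    (hσ : ∀ a, 0 < σ a)
    (hP : ∀ a, (P : Measure (Fin K → ℝ)).map (fun y => y a) = gaussianReal (μ a) (σ a ^ 2))
    (hQ : ∀ a, (Q : Measure (Fin K → ℝ)).map (fun y => y a) = gaussianReal (m a) (σ a ^ 2))
    (t : ℕ) {f : (Fin t → Fin K × ℝ) → ℝ≥0∞} (hf : Measurable f) :
    ∫⁻ y, f (π.history T y t) ∂outcomeLaw P =
      ∫⁻ y, f (π.history T y t) *
        ENNReal.ofReal (Real.exp (-historyLogRatio μ m σ (π.history T y t))) ∂outcomeLaw Q := by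
  induction t with
  | zero =>
    have h0 : ∀ y, π.history T y 0 = Fin.elim0 := fun _ => rfl
    simp [h0, historyLogRatio]
  | succ t ih =>
    have hlog := measurable_logRatio μ m σ
    have hD := measurable_historyLogRatio μ m σ t
    have hfe : Measurable fun p => f (π.extend T t p) := hf.comp (π.measurable_extend T t)
    have hFm : Measurable fun h => ∫⁻ x, f (π.extend T t (h, x)) ∂(P : Measure (Fin K → ℝ)) :=
      hfe.lintegral_prod_right'
    have hG : Measurable fun p : (Fin t → Fin K × ℝ) × (Fin K → ℝ) => f (π.extend T t p) *
        ENNReal.ofReal (Real.exp (-historyLogRatio μ m σ (π.extend T t p))) :=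
      hfe.mul (((measurable_historyLogRatio μ m σ (t + 1)).comp
        (π.measurable_extend T t)).neg.exp.ennreal_ofReal)
    simp only [history_succ]
    rw [π.lintegral_history_prod T P t hfe, ih hFm, π.lintegral_history_prod T Q t hG]
    refine lintegral_congr fun y => ?_
    generalize π.history T y t = h
    set a := π.alloc T t h
    -- Once the history is fixed, the arm is fixed and the new round enters through coordinate `a`
    -- only; the joint law of the arms plays no role.
    let φ : ℝ → ℝ≥0∞ := fun z => f (Fin.snoc (α := fun _ => Fin K × ℝ) h (a, z))
    have hφ : Measurable φ := hf.comp ((measurable_snoc t).comp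
      (measurable_const.prodMk (measurable_const.prodMk measurable_id)))
    have hla : Measurable fun z : ℝ => logRatio μ m σ (a, z) := hlog.comp measurable_prodMk_left
    have hleft : ∫⁻ x, f (π.extend T t (h, x)) ∂(P : Measure (Fin K → ℝ)) =
        ∫⁻ z, φ z * ENNReal.ofReal (Real.exp (-logRatio μ m σ (a, z)))
          ∂gaussianReal (m a) (σ a ^ 2) := by
      rw [← lintegral_gaussianReal_change_mean μ m (hσ a) hφ, ← hP a,
        lintegral_map hφ (measurable_pi_apply a)]
      rfl
    rw [hleft, ← hQ a, lintegral_map (by fun_prop) (measurable_pi_apply a),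
      ← lintegral_mul_const _ (by fun_prop)]
    refine lintegral_congr fun x => ?_
    rw [historyLogRatio_extend, neg_add, Real.exp_add, ENNReal.ofReal_mul (Real.exp_pos _).le,
      mul_assoc, mul_comm (ENNReal.ofReal _)]
    rfl

end Strategy

/-! ### The information inequality -/

/-- A lower bound on the mass that a change of measure with log-likelihood ratio `ℓ` leaves on
an event. -/
lemma ofReal_mul_exp_le_setLIntegral {Ω : Type*} [MeasurableSpace Ω] {ν : Measure Ω}
    [IsProbabilityMeasure ν] {ℓ : Ω → ℝ} (hℓ : Measurable ℓ) (hint : Integrable ℓ ν)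
    (hone : ∫⁻ x, ENNReal.ofReal (Real.exp (-ℓ x)) ∂ν ≤ 1) {E : Set Ω} (hE : MeasurableSet E)
    (hq : 0 < ν.real E) :
    ENNReal.ofReal (ν.real E * Real.exp (-((∫ x, ℓ x ∂ν + 1) / ν.real E))) ≤
      ∫⁻ x in E, ENNReal.ofReal (Real.exp (-ℓ x)) ∂ν := by
  set q := ν.real E
  set c := (∫ x, ℓ x ∂ν + 1) / q with hc
  have hexp : Integrable (fun x => Real.exp (-ℓ x)) ν := by
    refine ⟨hℓ.neg.exp.aestronglyMeasurable, ?_⟩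
    rw [hasFiniteIntegral_iff_ofReal (Eventually.of_forall fun x => (Real.exp_pos _).le)]
    exact hone.trans_lt ENNReal.one_lt_top
  have hexp1 : ∫ x in Eᶜ, Real.exp (-ℓ x) ∂ν ≤ 1 := by
    refine (setIntegral_le_integral hexp (Eventually.of_forall fun x => (Real.exp_pos _).le)).trans ?_
    rw [integral_eq_lintegral_of_nonneg_ae (Eventually.of_forall fun x => (Real.exp_pos _).le)
      hexp.aestronglyMeasurable]
    exact ENNReal.toReal_le_of_le_ofReal zero_le_one (by simpa using hone)
  -- From `-ℓ ≤ exp (-ℓ)` and total mass at most one. Hence the integral of `ℓ` over `E` is at most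
  -- `q * c`, which explains the `+ 1` in `c`.
  have hcompl : -1 ≤ ∫ x in Eᶜ, ℓ x ∂ν := by
    have h : ∫ x in Eᶜ, -ℓ x ∂ν ≤ ∫ x in Eᶜ, Real.exp (-ℓ x) ∂ν :=
      integral_mono hint.neg.integrableOn hexp.integrableOn fun x => by
        have := Real.add_one_le_exp (-ℓ x)
        dsimp only
        linarith
    rw [integral_neg] at h
    linarith
  have hsplit := integral_add_compl hE hint
  have hlin : Integrable (fun x => Real.exp (-c) * ((1 + c) - ℓ x)) ν :=
    ((integrable_const _).sub hint).const_mul _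
  -- The exponential lies above its tangent at `-c`; this takes the place of Jensen's inequality on
  -- `E`.
  have hmono : ∫ x in E, Real.exp (-c) * ((1 + c) - ℓ x) ∂ν ≤ ∫ x in E, Real.exp (-ℓ x) ∂ν := by
    refine integral_mono hlin.integrableOn hexp.integrableOn fun x => ?_
    have h1 := Real.add_one_le_exp (c - ℓ x)
    have h2 : Real.exp (-ℓ x) = Real.exp (-c) * Real.exp (c - ℓ x) := by
      rw [← Real.exp_add]; congr 1; ring
    dsimp only
    rw [h2]
    exact mul_le_mul_of_nonneg_left (by linarith) (Real.exp_pos _).le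
  have hval : ∫ x in E, Real.exp (-c) * ((1 + c) - ℓ x) ∂ν =
      Real.exp (-c) * (q * (1 + c) - ∫ x in E, ℓ x ∂ν) := by
    rw [integral_const_mul, integral_sub (integrable_const _) hint.integrableOn, setIntegral_const,
      smul_eq_mul]
  have hqc : q * c = ∫ x, ℓ x ∂ν + 1 := by rw [hc]; field_simp
  rw [← ofReal_integral_eq_lintegral_ofReal hexp.integrableOn
    (Eventually.of_forall fun x => (Real.exp_pos _).le)]
  refine ENNReal.ofReal_le_ofReal (le_trans ?_ hmono)
  rw [hval, mul_comm]
  exact mul_le_mul_of_nonneg_left (by nlinarith) (Real.exp_pos _).le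

/-- The log-ratio is affine in the outcome, so its expectation needs only the mean; the value is the
Kullback–Leibler divergence of two normal laws with equal variance. -/
lemma integrable_logRatio_eval {Q : Instance K} (μ : Fin K → ℝ) {m : Fin K → ℝ} {σ : Fin K → ℝ≥0}
    {a : Fin K}
    (hQ : (Q : Measure (Fin K → ℝ)).map (fun y => y a) = gaussianReal (m a) (σ a ^ 2)) :
    Integrable (fun y : Fin K → ℝ => logRatio μ m σ (a, y a)) (Q : Measure (Fin K → ℝ)) ∧
      ∫ y : Fin K → ℝ, logRatio μ m σ (a, y a) ∂(Q : Measure (Fin K → ℝ)) =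
        (m a - μ a) ^ 2 / (2 * (σ a : ℝ) ^ 2) := by
  have hid : Integrable (fun z : ℝ => z) (gaussianReal (m a) (σ a ^ 2)) :=
    (memLp_id_gaussianReal 1).integrable le_rfl
  have hlog : ∀ z : ℝ, logRatio μ m σ (a, z) =
      (m a - μ a) / (2 * (σ a : ℝ) ^ 2) * (2 * z - (m a + μ a)) := fun z => by
    simp only [logRatio]; ring
  have hi : Integrable (fun z : ℝ => logRatio μ m σ (a, z)) (gaussianReal (m a) (σ a ^ 2)) := by
    simp only [hlog]
    exact ((hid.const_mul 2).sub (integrable_const _)).const_mul _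
  have hev : AEMeasurable (fun y : Fin K → ℝ => y a) (Q : Measure (Fin K → ℝ)) :=
    (measurable_pi_apply a).aemeasurable
  refine ⟨(hQ ▸ hi).comp_aemeasurable hev, ?_⟩
  have hmap := integral_map hev (hQ ▸ hi).aestronglyMeasurable
  rw [← hmap, hQ]
  simp only [hlog]
  rw [integral_const_mul, integral_sub (hid.const_mul 2) (integrable_const _), integral_const_mul,
    integral_id_gaussianReal]
  simp
  ring

namespace Strategy

variable (π : Strategy K) (T : ℕ)

/-- The choice of arm depends on the past only, so in each term of the sum over arms the indicator
is independent of the new outcome and the expectation factors. -/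
lemma integrable_logRatio_arm {Q : Instance K} (μ : Fin K → ℝ) {m : Fin K → ℝ} {σ : Fin K → ℝ≥0}
    (hQ : ∀ a, (Q : Measure (Fin K → ℝ)).map (fun y => y a) = gaussianReal (m a) (σ a ^ 2))
    (t : ℕ) :
    Integrable (fun y => logRatio μ m σ (π.arm T t y, y t (π.arm T t y))) (outcomeLaw Q) ∧
      ∫ y, logRatio μ m σ (π.arm T t y, y t (π.arm T t y)) ∂outcomeLaw Q =
        ∑ a, (∫ y, (if π.arm T t y = a then (1 : ℝ) else 0) ∂outcomeLaw Q) *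
          ((m a - μ a) ^ 2 / (2 * (σ a : ℝ) ^ 2)) := by
  let X : Fin K → (ℕ → Fin K → ℝ) → ℝ := fun a y => if π.arm T t y = a then (1 : ℝ) else 0
  let Z : Fin K → (ℕ → Fin K → ℝ) → ℝ := fun a y => logRatio μ m σ (a, y t a)
  have heq : ∀ y, logRatio μ m σ (π.arm T t y, y t (π.arm T t y)) = ∑ a, X a y * Z a y :=
    fun y => by simp [X, Z]
  have hXm : ∀ a, Measurable (X a) := fun a =>
    Measurable.ite (π.measurable_arm T t (measurableSet_singleton a)) measurable_const
      measurable_const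
  have hXi : ∀ a, Integrable (X a) (outcomeLaw Q) := fun a =>
    Integrable.of_bound (hXm a).aestronglyMeasurable 1 (Eventually.of_forall fun y => by
      simp only [X]; split_ifs <;> simp)
  have hev : AEMeasurable (fun y : ℕ → Fin K → ℝ => y t) (outcomeLaw Q) :=
    (measurable_pi_apply t).aemeasurable
  have hZi : ∀ a, Integrable (Z a) (outcomeLaw Q) ∧
      ∫ y, Z a y ∂outcomeLaw Q = (m a - μ a) ^ 2 / (2 * (σ a : ℝ) ^ 2) := fun a => by
    have h := integrable_logRatio_eval μ (hQ a)
    rw [← map_eval_outcomeLaw Q t] at h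
    refine ⟨h.1.comp_aemeasurable hev, ?_⟩
    rw [← h.2, integral_map hev h.1.aestronglyMeasurable]
  have hind : ∀ a, IndepFun (X a) (Z a) (outcomeLaw Q) := fun a => by
    have hx : Measurable fun h : Fin t → Fin K × ℝ => if π.alloc T t h = a then (1 : ℝ) else 0 :=
      Measurable.ite (π.measurable_alloc T t (measurableSet_singleton a)) measurable_const
        measurable_const
    have hz : Measurable fun x : Fin K → ℝ => logRatio μ m σ (a, x a) :=
      (measurable_logRatio μ m σ).comp (measurable_const.prodMk (measurable_pi_apply a))
    exact (π.indepFun_history T Q t).comp hx hz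
  have hXZ : ∀ a, Integrable (fun y => X a y * Z a y) (outcomeLaw Q) := fun a =>
    (hind a).integrable_mul (hXi a) (hZi a).1
  simp only [heq]
  refine ⟨integrable_finsetSum _ fun a _ => hXZ a, ?_⟩
  rw [integral_finsetSum _ fun a _ => hXZ a]
  refine Finset.sum_congr rfl fun a _ => ?_
  rw [(hind a).integral_fun_mul_eq_mul_integral (hXi a).aestronglyMeasurable
    (hZi a).1.aestronglyMeasurable, (hZi a).2]

lemma integrable_historyLogRatio {Q : Instance K} (μ : Fin K → ℝ) {m : Fin K → ℝ}
    {σ : Fin K → ℝ≥0}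
    (hQ : ∀ a, (Q : Measure (Fin K → ℝ)).map (fun y => y a) = gaussianReal (m a) (σ a ^ 2))
    (t : ℕ) :
    Integrable (fun y => historyLogRatio μ m σ (π.history T y t)) (outcomeLaw Q) ∧
      ∫ y, historyLogRatio μ m σ (π.history T y t) ∂outcomeLaw Q =
        ∑ s ∈ Finset.range t,
          ∑ a, (∫ y, (if π.arm T s y = a then (1 : ℝ) else 0) ∂outcomeLaw Q) *
            ((m a - μ a) ^ 2 / (2 * (σ a : ℝ) ^ 2)) := by
  have heq : ∀ y, historyLogRatio μ m σ (π.history T y t) =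
      ∑ s ∈ Finset.range t, logRatio μ m σ (π.arm T s y, y s (π.arm T s y)) := fun y => by
    induction t with
    | zero => simp [historyLogRatio]
    | succ t ih =>
      rw [history_succ, historyLogRatio_extend, Finset.sum_range_succ, ih]
      rfl
  simp only [heq]
  refine ⟨integrable_finsetSum _ fun s _ => (π.integrable_logRatio_arm T μ hQ s).1, ?_⟩
  rw [integral_finsetSum _ fun s _ => (π.integrable_logRatio_arm T μ hQ s).1]
  exact Finset.sum_congr rfl fun s _ => (π.integrable_logRatio_arm T μ hQ s).2

lemma allocationRatio_eq (Q : Instance K) (a : Fin K) :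
    allocationRatio π T Q a = (1 / (T : ℝ)) * ∑ t ∈ Finset.range T,
      ∫ y, (if π.arm T t y = a then (1 : ℝ) else 0) ∂outcomeLaw Q := by
  unfold allocationRatio
  rw [integral_const_mul, integral_finsetSum]
  intro t _
  refine Integrable.of_bound (Measurable.ite (π.measurable_arm T t (measurableSet_singleton a))
    measurable_const measurable_const).aestronglyMeasurable 1 (Eventually.of_forall fun y => ?_)
  split_ifs <;> simp

lemma integral_historyLogRatio {Q : Instance K} (μ : Fin K → ℝ) {m : Fin K → ℝ}
    {σ : Fin K → ℝ≥0}
    (hQ : ∀ a, (Q : Measure (Fin K → ℝ)).map (fun y => y a) = gaussianReal (m a) (σ a ^ 2))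
    (hT : T ≠ 0) :
    ∫ y, historyLogRatio μ m σ (π.history T y T) ∂outcomeLaw Q =
      T * ∑ a, allocationRatio π T Q a * ((m a - μ a) ^ 2 / (2 * (σ a : ℝ) ^ 2)) := by
  have hT' : (T : ℝ) ≠ 0 := by exact_mod_cast hT
  rw [(π.integrable_historyLogRatio T μ hQ T).2, Finset.sum_comm, Finset.mul_sum]
  refine Finset.sum_congr rfl fun a _ => ?_
  rw [allocationRatio_eq, ← Finset.sum_mul, ← mul_assoc, ← mul_assoc, mul_one_div_cancel hT',
    one_mul]

lemma measurableSet_recommended (s : Set (Fin K)) :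
    MeasurableSet {y | π.recommended T y ∈ s} :=
  ((π.measurable_recommend T).comp (π.measurable_history T T)) s.toFinite.measurableSet

/-- The information inequality: a lower bound on the error probability under `P` in terms of the
error probability and the allocation ratios under an alternative `Q`. -/
lemma ofReal_le_outcomeLaw_recommended {P Q : Instance K} {μ m : Fin K → ℝ} {σ : Fin K → ℝ≥0}
    (hσ : ∀ a, 0 < σ a)
    (hP : ∀ a, (P : Measure (Fin K → ℝ)).map (fun y => y a) = gaussianReal (μ a) (σ a ^ 2))
    (hQ : ∀ a, (Q : Measure (Fin K → ℝ)).map (fun y => y a) = gaussianReal (m a) (σ a ^ 2))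
    (aStar : Fin K) (hT : T ≠ 0) {q : ℝ}
    (hq : q = (outcomeLaw Q).real {y | π.recommended T y ≠ aStar}) (hq0 : 0 < q) :
    ENNReal.ofReal (q * Real.exp (-((T * ∑ a, allocationRatio π T Q a *
        ((m a - μ a) ^ 2 / (2 * (σ a : ℝ) ^ 2)) + 1) / q))) ≤
      outcomeLaw P {y | π.recommended T y ≠ aStar} := by
  subst hq
  have hE : MeasurableSet {y | π.recommended T y ≠ aStar} :=
    π.measurableSet_recommended T {aStar}ᶜ
  have hB : MeasurableSet {h | π.recommend T h ≠ aStar} :=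
    π.measurable_recommend T (Set.toFinite ({aStar}ᶜ : Set (Fin K))).measurableSet
  -- The change of measure applied to the constant `1`.
  have hone : ∫⁻ y, ENNReal.ofReal (Real.exp (-historyLogRatio μ m σ (π.history T y T)))
      ∂outcomeLaw Q ≤ 1 := by
    have h := π.lintegral_history_change_mean T hσ hP hQ T (f := fun _ => 1) measurable_const
    simp only [one_mul] at h
    rw [← h]
    simp
  have h := π.lintegral_history_change_mean T hσ hP hQ T
    (f := {h | π.recommend T h ≠ aStar}.indicator 1) (measurable_one.indicator hB)
  have hl : ∫⁻ y, {h | π.recommend T h ≠ aStar}.indicator 1 (π.history T y T) ∂outcomeLaw P =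
      outcomeLaw P {y | π.recommended T y ≠ aStar} := by
    rw [← lintegral_indicator_one hE]
    rfl
  rw [← hl, h, ← π.integral_historyLogRatio T μ hQ hT]
  refine (ofReal_mul_exp_le_setLIntegral ((measurable_historyLogRatio μ m σ T).comp
    (π.measurable_history T T)) (π.integrable_historyLogRatio T μ hQ T).1 hone hE hq0).trans ?_
  rw [← lintegral_indicator hE]
  refine lintegral_mono fun y => ?_
  by_cases hy : π.recommended T y = aStar
  · simp [hy]
  · have : π.recommend T (π.history T y T) ≠ aStar := hy
    simp [hy, this]

end Strategy

/-! ### Choice of the alternative -/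

lemma map_eval_indepGaussian (m : Fin K → ℝ) (σ : Fin K → ℝ≥0) (a : Fin K) :
    (indepGaussian m σ : Measure (Fin K → ℝ)).map (fun y => y a) =
      gaussianReal (m a) (σ a ^ 2) :=
  (measurePreserving_eval (fun a => gaussianReal (m a) (σ a ^ 2)) a).map_eq

lemma mean_indepGaussian (m : Fin K → ℝ) (σ : Fin K → ℝ≥0) (a : Fin K) :
    mean (indepGaussian m σ) a = m a := by
  have h := integral_map (μ := (indepGaussian m σ : Measure (Fin K → ℝ))) (f := fun z : ℝ => z)
    (measurable_pi_apply a).aemeasurable measurable_id.aestronglyMeasurable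
  rw [map_eval_indepGaussian, integral_id_gaussianReal] at h
  exact h.symm

/-- Moving the means of two arms with gap `Δ` to a common value costs `Δ² / (2 Ω)`. -/
lemma cost_of_equalizing {σ : Fin K → ℝ≥0} (hσ : ∀ a, 0 < σ a) {w : Fin K → ℝ}
    (hw : ∀ a, 0 < w a) (μ : Fin K → ℝ) {a b : Fin K} (hab : b ≠ a) :
    ∃ m : Fin K → ℝ, m b = m a ∧
      ∑ c, w c * ((m c - μ c) ^ 2 / (2 * (σ c : ℝ) ^ 2)) =
        (μ a - μ b) ^ 2 / (2 * Omega σ a b w) := by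
  have hσa : (0 : ℝ) < σ a := hσ a
  have hσb : (0 : ℝ) < σ b := hσ b
  have hwa := hw a
  have hwb := hw b
  have hΩ : 0 < Omega σ a b w := by unfold Omega; positivity
  set Ω := Omega σ a b w with hΩdef
  -- Minimising the weighted quadratic cost subject to `x + z = μ a - μ b` makes the shifts
  -- proportional to variance over weight.
  let x : ℝ := (μ a - μ b) * ((σ a : ℝ) ^ 2 / w a) / Ω
  let z : ℝ := (μ a - μ b) * ((σ b : ℝ) ^ 2 / w b) / Ω
  have hsum : x + z = μ a - μ b := by
    have : x + z = (μ a - μ b) * Ω / Ω := by simp only [x, z, hΩdef, Omega]; ring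
    rw [this, mul_div_cancel_right₀ _ hΩ.ne']
  refine ⟨Function.update (Function.update μ a (μ a - x)) b (μ b + z), ?_, ?_⟩
  · rw [Function.update_self, Function.update_of_ne hab.symm, Function.update_self]
    linarith
  · rw [Fintype.sum_eq_add a b hab.symm]
    · rw [Function.update_self, Function.update_of_ne hab.symm, Function.update_self]
      have h1 : w a * ((μ a - x - μ a) ^ 2 / (2 * (σ a : ℝ) ^ 2)) =
          (μ a - μ b) ^ 2 / (2 * Ω ^ 2) * ((σ a : ℝ) ^ 2 / w a) := by
        simp only [x]; field_simp; ring
      have h2 : w b * ((μ b + z - μ b) ^ 2 / (2 * (σ b : ℝ) ^ 2)) =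
          (μ a - μ b) ^ 2 / (2 * Ω ^ 2) * ((σ b : ℝ) ^ 2 / w b) := by
        simp only [z]; field_simp; ring
      rw [h1, h2, ← mul_add]
      change _ * Ω = _
      field_simp
    · rintro c ⟨hca, hcb⟩
      rw [Function.update_of_ne hcb, Function.update_of_ne hca]
      simp

/-- If some other arm is at least as good as `a`, then adding any `ε > 0` to a suitable mean makes
some other arm the unique best one. -/
lemma exists_unique_best_perturbation {m : Fin K → ℝ} {a b : Fin K} (hab : b ≠ a)
    (hm : m a ≤ m b) :
    ∃ c, c ≠ a ∧ ∀ ε : ℝ, 0 < ε → ∀ d, d ≠ c →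
      Function.update m c (m c + ε) d < Function.update m c (m c + ε) c := by
  -- A best arm among those other than `a`. It need not be `b`, but it does not depend on `ε`.
  obtain ⟨c, hc, hmax⟩ := Finset.exists_max_image (Finset.univ.erase a) m
    ⟨b, Finset.mem_erase.2 ⟨hab, Finset.mem_univ b⟩⟩
  refine ⟨c, Finset.ne_of_mem_erase hc, fun ε hε d hd => ?_⟩
  rw [Function.update_self, Function.update_of_ne hd]
  have hle : m d ≤ m c := by
    by_cases hda : d = a
    · subst hda
      exact hm.trans (hmax b (Finset.mem_erase.2 ⟨hab, Finset.mem_univ b⟩))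
    · exact hmax d (Finset.mem_erase.2 ⟨hda, Finset.mem_univ d⟩)
  linarith

/-! ### Passage to the limit -/

namespace Strategy

variable (π : Strategy K)

lemma complexity_le {P Q : Instance K} {μ m : Fin K → ℝ} {σ : Fin K → ℝ≥0}
    (hσ : ∀ a, 0 < σ a)
    (hP : ∀ a, (P : Measure (Fin K → ℝ)).map (fun y => y a) = gaussianReal (μ a) (σ a ^ 2))
    (hQ : ∀ a, (Q : Measure (Fin K → ℝ)).map (fun y => y a) = gaussianReal (m a) (σ a ^ 2))
    (aStar : Fin K) {T : ℕ} (hT : T ≠ 0) {q : ℝ}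
    (hq : q = (outcomeLaw Q).real {y | π.recommended T y ≠ aStar}) (hq0 : 0 < q) :
    complexity π P aStar T ≤
      ((-(Real.log q * (1 / (T : ℝ))) + (∑ a, allocationRatio π T Q a *
        ((m a - μ a) ^ 2 / (2 * (σ a : ℝ) ^ 2)) + 1 / (T : ℝ)) / q : ℝ) : EReal) := by
  have hT' : (T : ℝ) ≠ 0 := by exact_mod_cast hT
  have h := ENNReal.log_le_log
    (π.ofReal_le_outcomeLaw_recommended T hσ hP hQ aStar hT hq hq0)
  rw [ENNReal.log_ofReal_of_pos (by positivity), Real.log_mul hq0.ne' (Real.exp_pos _).ne',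
    Real.log_exp] at h
  have h' := EReal.neg_le_neg_iff.2
    (mul_le_mul_of_nonneg_left h (EReal.coe_nonneg.2 (by positivity : (0 : ℝ) ≤ 1 / (T : ℝ))))
  rw [← EReal.coe_mul, ← EReal.coe_neg] at h'
  unfold complexity
  rw [EReal.coe_neg, EReal.neg_mul]
  refine h'.trans (EReal.coe_le_coe_iff.2 (le_of_eq ?_))
  field_simp
  ring

/-- The transportation bound for one alternative with a different unique best arm. -/
lemma limsup_complexity_le {P Q : Instance K} {μ m : Fin K → ℝ} {σ : Fin K → ℝ≥0}
    (hσ : ∀ a, 0 < σ a)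
    (hP : ∀ a, (P : Measure (Fin K → ℝ)).map (fun y => y a) = gaussianReal (μ a) (σ a ^ 2))
    (hQ : ∀ a, (Q : Measure (Fin K → ℝ)).map (fun y => y a) = gaussianReal (m a) (σ a ^ 2))
    {aStar b : Fin K} (hb : b ≠ aStar)
    (hcons : Tendsto (fun T : ℕ => outcomeLaw Q {y | π.recommended T y = b}) atTop (𝓝 1))
    {w : Fin K → ℝ} (hw : ∀ a, Tendsto (fun T : ℕ => allocationRatio π T Q a) atTop (𝓝 (w a))) :
    limsup (fun T : ℕ => complexity π P aStar T) atTop ≤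
      ((∑ a, w a * ((m a - μ a) ^ 2 / (2 * (σ a : ℝ) ^ 2)) : ℝ) : EReal) := by
  let q : ℕ → ℝ := fun T => (outcomeLaw Q).real {y | π.recommended T y ≠ aStar}
  have hq : Tendsto q atTop (𝓝 1) := by
    have h1 : Tendsto (fun T : ℕ => (outcomeLaw Q).real {y | π.recommended T y = b}) atTop
        (𝓝 1) := by
      simpa [Function.comp_def, measureReal_def] using
        (ENNReal.tendsto_toReal ENNReal.one_ne_top).comp hcons
    -- Recommending `b` entails not recommending `aStar`, so `q` is squeezed between a sequence
    -- tending to one and one.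
    refine tendsto_of_tendsto_of_tendsto_of_le_of_le h1 tendsto_const_nhds (fun T => ?_)
      fun T => measureReal_le_one
    refine measureReal_mono fun y (hy : _ = b) => ?_
    exact fun h => hb (hy.symm.trans h)
  have hinv : Tendsto (fun T : ℕ => 1 / (T : ℝ)) atTop (𝓝 0) := tendsto_one_div_atTop_nhds_zero_nat
  have hlog : Tendsto (fun T => Real.log (q T)) atTop (𝓝 0) := by
    simpa using hq.log one_ne_zero
  have hsum : Tendsto (fun T : ℕ => ∑ a, allocationRatio π T Q a *
      ((m a - μ a) ^ 2 / (2 * (σ a : ℝ) ^ 2))) atTop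
      (𝓝 (∑ a, w a * ((m a - μ a) ^ 2 / (2 * (σ a : ℝ) ^ 2)))) :=
    tendsto_finsetSum _ fun a _ => (hw a).mul_const _
  have hlim := (hlog.mul hinv).neg.add ((hsum.add hinv).div hq one_ne_zero)
  simp only [mul_zero, neg_zero, zero_add, add_zero, div_one] at hlim
  rw [← ((continuous_coe_real_ereal.tendsto _).comp hlim).limsup_eq]
  refine limsup_le_limsup ?_
  filter_upwards [eventually_ne_atTop 0, hq.eventually_const_lt one_pos] with T hT hqT
  exact π.complexity_le hσ hP hQ aStar hT rfl hqT

end Strategy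

end FixedBudgetBAI

theorem mainTheorem8 (K : ℕ) (hK : 2 ≤ K)
    (σ : Fin K → ℝ≥0) (hσ : ∀ a, 0 < σ a)
    (M : Set (FixedBudgetBAI.Instance K))
    (hM : M ⊆ FixedBudgetBAI.uniqueBestArmInstances K)
    (hM_gaussian : ∀ (m : Fin K → ℝ) (a : Fin K), (∀ b, b ≠ a → m b < m a) →
      FixedBudgetBAI.indepGaussian m σ ∈ M)
    (Δlo Δhi : ℝ) (hΔlo : 0 < Δlo) (hΔ : Δlo ≤ Δhi)
    (aStar : Fin K) (P₀ : FixedBudgetBAI.Instance K)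
    (hP₀ : P₀ ∈ FixedBudgetBAI.gaussianModel M σ aStar Δlo Δhi)
    (π : FixedBudgetBAI.Strategy K)
    (hcons : FixedBudgetBAI.IsConsistent M π)
    (hinv : FixedBudgetBAI.IsAsymptoticallyInvariant M π) :
    limsup (fun T : ℕ => FixedBudgetBAI.complexity π P₀ aStar T) atTop ≤
      ⨆ w ∈ FixedBudgetBAI.allocations K, ⨅ a : {a : Fin K // a ≠ aStar},
        (((FixedBudgetBAI.mean P₀ aStar - FixedBudgetBAI.mean P₀ a) ^ 2 /
          (2 * FixedBudgetBAI.Omega σ aStar a w) : ℝ) : EReal) := by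
  obtain ⟨-, hP, -⟩ := hP₀
  obtain ⟨w, hw, hlim⟩ := hinv
  refine le_iSup₂_of_le w hw (le_iInf fun b => ?_)
  obtain ⟨b, hb⟩ := b
  obtain ⟨m, hm, hcost⟩ := FixedBudgetBAI.cost_of_equalizing hσ (fun a => (hw.1 a).1)
    (FixedBudgetBAI.mean P₀) hb
  obtain ⟨c, hc, hbest⟩ := FixedBudgetBAI.exists_unique_best_perturbation hb hm.ge
  rw [← hcost]
  -- The equalised means `m` may have tied best arms, so the alternative is taken at the perturbed
  -- means.
  have hbound : ∀ ε : ℝ, 0 < ε →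
      limsup (fun T : ℕ => FixedBudgetBAI.complexity π P₀ aStar T) atTop ≤
        ((∑ a, w a * ((Function.update m c (m c + ε) a - FixedBudgetBAI.mean P₀ a) ^ 2 /
          (2 * (σ a : ℝ) ^ 2)) : ℝ) : EReal) := fun ε hε => by
    have hQM := hM_gaussian _ c (hbest ε hε)
    refine π.limsup_complexity_le hσ hP (FixedBudgetBAI.map_eval_indepGaussian _ σ) hc
      (hcons _ hQM c fun d hd => ?_) (hlim _ hQM)
    simpa only [FixedBudgetBAI.mean_indepGaussian] using hbest ε hε d hd
  have hcont : Continuous fun ε : ℝ =>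
      ((∑ a, w a * ((Function.update m c (m c + ε) a - FixedBudgetBAI.mean P₀ a) ^ 2 /
        (2 * (σ a : ℝ) ^ 2)) : ℝ) : EReal) := by
    have hupd : ∀ a, Continuous fun ε : ℝ => Function.update m c (m c + ε) a := fun a =>
      (continuous_apply a).comp
        ((continuous_const (y := m)).update c (by fun_prop : Continuous fun ε : ℝ => m c + ε))
    refine continuous_coe_real_ereal.comp (continuous_finsetSum _ fun a _ => ?_)
    exact continuous_const.mul ((((hupd a).sub continuous_const).pow 2).div_const _)
  have htend := (hcont.tendsto 0).mono_left (nhdsWithin_le_nhds (s := Set.Ioi 0))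
  rw [add_zero, Function.update_eq_self] at htend
  exact ge_of_tendsto htend (eventually_nhdsWithin_of_forall fun ε hε => hbound ε hε)
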